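/- Let $\{\alpha_n\}_{n\ge 0}$ be a sequence of complex numbers with $|\alpha_n|<1$ for all $n$ (a sequence of Verblunsky coefficients), let $\gamma\in(0,1)$, and assume that $$\sum_{n=0}^\infty n^\gamma|\alpha_n|^2<\infty .$$ For $\beta\in[0,2\pi)$ let $\Phi_n(z,\beta)$ be the monic polynomials with Verblunsky coefficients $\{e^{i\beta}\alpha_n\}_{n\ge 0}$, that is, $\Phi_0(z,\beta)=1$ and $$\Phi_{n+1}(z,\beta)=z\,\Phi_n(z,\beta)-\overline{e^{i\beta}\alpha_n}\,\Phi_n^*(z,\beta),\qquad \Phi_n^*(z,\beta)=z^n\,\overline{\Phi_n(1/\overline z,\beta)},\qquad n\ge 0 .$$ The Prüfer radius $R_n(\eta,\beta)>0$ is defined by the polar representation $\Phi_n(e^{i\eta},\beta)=R_n(\eta,\beta)\,e^{i(n\eta+\theta_n(\eta,\beta))}$ with $\theta_n(\eta,\beta)$ real; that is, $R_n(\eta,\beta)=|\Phi_n(e^{i\eta},\beta)|$. Let $\nu$ be a finite Borel measure on $(0,2\pi)$ such that (i) there is a $\delta>0$ such that $\nu$ is supported by $(\delta,2\pi-\delta)$,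 i.e. the complement of this interval has $\nu$-measure zero; (ii) there are $D\in(1-\gamma,1)$ and $C<\infty$ such that $\nu(I)\le C|I|^D$ for every interval $I\subseteq(0,2\pi)$. Then, for $\nu$-almost every $\eta$, $$\sup\{R_n(\eta,\beta) : \beta\in[0,2\pi),\ n\in\mathbb Z_{+}\}<\infty,\qquad \mathbb Z_+=\{0,1,2,\dots\}.$$ -/

import Mathlib

namespace OPUC

noncomputable section

open Polynomial

/-- The Szegő dual of degree `n`, `P^*(z) = z ^ n * conj (P (1 / conj z))`: conjugate the
coefficients and reverse their order, `X ^ k ↦ X ^ (n - k)`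
(see `eval_szegoDual`). -/
def szegoDual (n : ℕ) (P : ℂ[X]) : ℂ[X] :=
  (P.map (starRingEnd ℂ)).reflect n

/-- The monic orthogonal polynomials `Φ_n` with Verblunsky coefficients `α`, generated from `Φ_0 = 1`
by the Szegő recurrence `Φ_{n+1}(z) = z Φ_n(z) - conj (α_n) Φ_n^*(z)`. -/
def monicPoly (α : ℕ → ℂ) : ℕ → ℂ[X]
  | 0 => 1
  | n + 1 => X * monicPoly α n
      - C (starRingEnd ℂ (α n)) * szegoDual n (monicPoly α n)

/-- `Φ_n(·, β)`: the monic polynomials with Verblunsky coefficients `e^{iβ} α_n`. -/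
def rotatedPoly (α : ℕ → ℂ) (β : ℝ) (n : ℕ) : ℂ[X] :=
  monicPoly (fun k => Complex.exp (Complex.I * β) * α k) n

/-- The Prüfer radius `R_n(η, β)`: the radius in the polar representation
`Φ_n(e^{iη}, β) = R_n(η, β) exp (i (n η + θ_n(η, β)))`
(see `pruferRadius_pos` and `eq_pruferRadius`). -/
def pruferRadius (α : ℕ → ℂ) (n : ℕ) (η β : ℝ) : ℝ :=
  ‖(rotatedPoly α β n).eval (Complex.exp (Complex.I * η))‖

/-- `ν` is uniformly `D`-Hölder continuous on `(0, 2π)`: there is a constant `K` with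
`ν(I) ≤ K |I| ^ D` for every interval `I ⊆ (0, 2π)`. -/
def UniformlyHolder (ν : MeasureTheory.Measure ℝ) (D : ℝ) : Prop :=
  ∃ K : NNReal, ∀ I : Set ℝ, I.OrdConnected → I ⊆ Set.Ioo 0 (2 * Real.pi) →
    ν I ≤ K * MeasureTheory.volume I ^ D

theorem natDegree_szegoDual_le (n : ℕ) (P : ℂ[X]) (h : P.natDegree ≤ n) :
    (szegoDual n P).natDegree ≤ n := by
  refine (natDegree_reflect_le).trans ?_
  exact max_le le_rfl ((natDegree_map_le).trans h)

theorem natDegree_monicPoly_le (α : ℕ → ℂ) (n : ℕ) : (monicPoly α n).natDegree ≤ n := by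
  induction n with
  | zero => simp [monicPoly]
  | succ n ih =>
    rw [monicPoly]
    refine (natDegree_sub_le _ _).trans (max_le ?_ ?_)
    · refine (natDegree_mul_le).trans ?_
      have := natDegree_X_le (R := ℂ)
      omega
    · refine (natDegree_C_mul_le _ _).trans ?_
      exact (natDegree_szegoDual_le n _ ih).trans n.le_succ

theorem eval_szegoDual (n : ℕ) (P : ℂ[X]) (h : P.natDegree ≤ n) (z : ℂ) (hz : z ≠ 0) :
    (szegoDual n P).eval z = z ^ n * starRingEnd ℂ (P.eval (1 / starRingEnd ℂ z)) := by
  have hz1 : z⁻¹ ≠ 0 := inv_ne_zero hz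
  letI : Invertible z⁻¹ := invertibleOfNonzero hz1
  have h1 := eval₂_reflect_mul_pow (RingHom.id ℂ) z⁻¹ n (P.map (starRingEnd ℂ))
    ((natDegree_map_le).trans h)
  rw [invOf_eq_inv, inv_inv] at h1
  have h2 : (P.map (starRingEnd ℂ)).eval z⁻¹
      = starRingEnd ℂ (P.eval (1 / starRingEnd ℂ z)) := by
    have h3 : z⁻¹ = starRingEnd ℂ (1 / starRingEnd ℂ z) := by simp
    rw [h3, eval_map_apply]
  rw [← h2]
  have h4 : (szegoDual n P).eval z * z⁻¹ ^ n = (P.map (starRingEnd ℂ)).eval z⁻¹ := h1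
  rw [← h4, inv_pow]
  field_simp

theorem monicPoly_eval_ne_zero (α : ℕ → ℂ) (hα : ∀ n, ‖α n‖ < 1) (z : ℂ) (hz : ‖z‖ = 1)
    (n : ℕ) : (monicPoly α n).eval z ≠ 0 := by
  induction n with
  | zero => simp [monicPoly]
  | succ n ih =>
    have hz0 : z ≠ 0 := by
      rintro rfl
      simp at hz
    have hzz : 1 / starRingEnd ℂ z = z := by
      rw [one_div, ← map_inv₀, Complex.inv_eq_conj hz, Complex.conj_conj]
    intro h0
    rw [monicPoly, eval_sub, eval_mul, eval_mul, eval_X, eval_C,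
      eval_szegoDual n _ (natDegree_monicPoly_le α n) z hz0, hzz, sub_eq_zero] at h0
    have h1 := congrArg norm h0
    simp only [norm_mul, norm_pow, hz, one_pow, one_mul, RCLike.norm_conj] at h1
    have h2 : 0 < ‖(monicPoly α n).eval z‖ := norm_pos_iff.mpr ih
    nlinarith [hα n]

theorem pruferRadius_pos (α : ℕ → ℂ) (hα : ∀ n, ‖α n‖ < 1) (n : ℕ) (η β : ℝ) :
    0 < pruferRadius α n η β := by
  refine norm_pos_iff.mpr (monicPoly_eval_ne_zero _ (fun k => ?_) _ ?_ n)
  · rw [norm_mul, mul_comm Complex.I, Complex.norm_exp_ofReal_mul_I, one_mul]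
    exact hα k
  · rw [mul_comm, Complex.norm_exp_ofReal_mul_I]

theorem eq_pruferRadius (α : ℕ → ℂ) (n : ℕ) (η β r θ : ℝ) (hr : 0 < r)
    (h : (rotatedPoly α β n).eval (Complex.exp (Complex.I * η))
      = r * Complex.exp (Complex.I * (n * η + θ))) :
    r = pruferRadius α n η β := by
  have h1 : ((n : ℂ) * η + θ) = ((n * η + θ : ℝ) : ℂ) := by push_cast; rfl
  rw [pruferRadius, h, norm_mul, h1, mul_comm Complex.I, Complex.norm_exp_ofReal_mul_I,
    mul_one, Complex.norm_real, Real.norm_of_nonneg hr.le]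

end

end OPUC

/-!
On the unit circle, `z ^ (-n) * Φ_n(z)` is an ordered product of factors `1 + A j` applied to `1`,
where `A j` is a real-linear map of norm `|α j|`. The phase `e^{iβ}` rotates all `A j`
simultaneously, so the norms of their sums over windows are those of the partial sums of
`∑ α j * z ^ j`, whatever `β` is; bounds in terms of these norms are uniform in `β`.

Over a dyadic window the ordered product is `1 + ∑ A j` up to an error controlled by the dyadic
energy, the sum of `‖∑ j ∈ J, A j‖ ^ 2` over all dyadic subintervals `J`. Hence the products stay
bounded as soon as the energies `E k` of the windows `[2 ^ k, 2 ^ (k + 1))` satisfy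
`∑ k * √(E k) < ∞`.

A polynomial of degree less than `L` is essentially constant at scale `1 / L` on the circle: by
Parseval and a one-dimensional Sobolev inequality on each arc of length `2π / L`, its square
integral against a `D`-Hölder measure exceeds the sum of its squared coefficients by at most a
factor `O(L ^ (1 - D))`. So the `ν`-integral of `E k` is `O(k * 2 ^ (k * (1 - D - γ)))`, and as
`1 - D < γ` the energies decay geometrically almost everywhere.
-/

namespace OPUC

open MeasureTheory Finset Polynomial
open scoped Real

/-! ### Ordered products and dyadic energy -/

/-- The ordered product `(1 + A (a + n - 1)) * ⋯ * (1 + A a)`, the propagator of the recurrence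
`u (j + 1) = (1 + A j) * u j` over `n` steps starting at `a`. -/
def transfer {R : Type*} [Semiring R] (A : ℕ → R) (a : ℕ) : ℕ → R
  | 0 => 1
  | n + 1 => (1 + A (a + n)) * transfer A a n

/-- The sum of the `n` consecutive terms `A a, …, A (a + n - 1)`, parametrised by starting point
and length like `transfer`, whose linearisation at `A = 0` it is. -/
def windowSum {E : Type*} [AddCommMonoid E] (A : ℕ → E) (a n : ℕ) : E :=
  ∑ i ∈ range n, A (a + i)

/-- The sum of `‖∑ i ∈ J, A i‖ ^ 2` over all dyadic subintervals `J` of `[a, a + 2 ^ d)`, down to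
single points: the square function that controls `transfer A a (2 ^ d)`. -/
def dyadicEnergy {E : Type*} [SeminormedAddCommGroup E] (A : ℕ → E) : ℕ → ℕ → ℝ
  | 0, a => ‖windowSum A a 1‖ ^ 2
  | d + 1, a => ‖windowSum A a (2 ^ (d + 1))‖ ^ 2
      + (dyadicEnergy A d a + dyadicEnergy A d (a + 2 ^ d))

theorem transfer_add {R : Type*} [Semiring R] (A : ℕ → R) (a m n : ℕ) :
    transfer A a (m + n) = transfer A (a + m) n * transfer A a m := by
  induction n with
  | zero => simp [transfer]
  | succ n ih => rw [← add_assoc, transfer, transfer, ih, mul_assoc, add_assoc]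

theorem transfer_two_pow_succ {R : Type*} [Semiring R] (A : ℕ → R) (a d : ℕ) :
    transfer A a (2 ^ (d + 1)) = transfer A (a + 2 ^ d) (2 ^ d) * transfer A a (2 ^ d) := by
  rw [pow_succ, mul_two, transfer_add]

theorem windowSum_two_pow_succ {E : Type*} [AddCommMonoid E] (A : ℕ → E) (a d : ℕ) :
    windowSum A a (2 ^ (d + 1)) = windowSum A a (2 ^ d) + windowSum A (a + 2 ^ d) (2 ^ d) := by
  simp only [pow_succ, mul_two, windowSum, sum_range_add, add_assoc]

section DyadicEnergy

variable {E F : Type*} [SeminormedAddCommGroup E] [SeminormedAddCommGroup F]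

theorem dyadicEnergy_nonneg (A : ℕ → E) (d a : ℕ) : 0 ≤ dyadicEnergy A d a := by
  induction d generalizing a with
  | zero => exact sq_nonneg _
  | succ d ih => exact add_nonneg (sq_nonneg _) (add_nonneg (ih _) (ih _))

theorem sq_norm_windowSum_le_dyadicEnergy (A : ℕ → E) (d a : ℕ) :
    ‖windowSum A a (2 ^ d)‖ ^ 2 ≤ dyadicEnergy A d a := by
  cases d with
  | zero => rfl
  | succ d =>
    exact le_add_of_nonneg_right (add_nonneg (dyadicEnergy_nonneg ..) (dyadicEnergy_nonneg ..))

theorem dyadicEnergy_left_le (A : ℕ → E) (d a : ℕ) :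
    dyadicEnergy A d a ≤ dyadicEnergy A (d + 1) a := by
  rw [dyadicEnergy]
  linarith [sq_nonneg ‖windowSum A a (2 ^ (d + 1))‖, dyadicEnergy_nonneg A d (a + 2 ^ d)]

theorem dyadicEnergy_right_le (A : ℕ → E) (d a : ℕ) :
    dyadicEnergy A d (a + 2 ^ d) ≤ dyadicEnergy A (d + 1) a := by
  rw [dyadicEnergy]
  linarith [sq_nonneg ‖windowSum A a (2 ^ (d + 1))‖, dyadicEnergy_nonneg A d a]

theorem dyadicEnergy_congr {A : ℕ → E} {B : ℕ → F}
    (hAB : ∀ a n, ‖windowSum A a n‖ = ‖windowSum B a n‖) (d a : ℕ) :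
    dyadicEnergy A d a = dyadicEnergy B d a := by
  induction d generalizing a with
  | zero => simp only [dyadicEnergy, hAB]
  | succ d ih => simp only [dyadicEnergy, hAB, ih]

theorem norm_eq_of_norm_windowSum_eq {A : ℕ → E} {B : ℕ → F}
    (hAB : ∀ a n, ‖windowSum A a n‖ = ‖windowSum B a n‖) (n : ℕ) : ‖A n‖ = ‖B n‖ := by
  simpa [windowSum] using hAB n 1

end DyadicEnergy

section NormTransfer

variable {R : Type*} [NormedRing R]

theorem norm_mul_sub_one_sub_add_le (x y s t : R) :
    ‖x * y - 1 - (t + s)‖ ≤ ‖x - 1 - s‖ + ‖x - 1 - s‖ ^ 2 + ‖s‖ ^ 2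
      + (‖y - 1 - t‖ + ‖y - 1 - t‖ ^ 2 + ‖t‖ ^ 2) := by
  have hexpand : x * y - 1 - (t + s) = (x - 1 - s) + (y - 1 - t)
      + (s + (x - 1 - s)) * (t + (y - 1 - t)) := by noncomm_ring
  have hnorm : ‖x * y - 1 - (t + s)‖ ≤ ‖x - 1 - s‖ + ‖y - 1 - t‖
      + (‖s‖ + ‖x - 1 - s‖) * (‖t‖ + ‖y - 1 - t‖) := by
    rw [hexpand]
    refine norm_add₃_le.trans ?_
    gcongr
    refine (norm_mul_le _ _).trans ?_
    gcongr <;> exact norm_add_le _ _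
  linarith [two_mul_le_add_sq (‖s‖ + ‖x - 1 - s‖) (‖t‖ + ‖y - 1 - t‖),
    add_sq_le (a := ‖s‖) (b := ‖x - 1 - s‖), add_sq_le (a := ‖t‖) (b := ‖y - 1 - t‖)]

theorem one_add_pow_le_three {x : ℝ} {n : ℕ} (hx : 0 ≤ x) (hn : n * x ≤ 1) :
    (1 + x) ^ n ≤ 3 := by
  calc (1 + x) ^ n ≤ Real.exp x ^ n := by gcongr; linarith [Real.add_one_le_exp x]
    _ = Real.exp (n * x) := (Real.exp_nat_mul _ _).symm
    _ ≤ Real.exp 1 := Real.exp_le_exp.2 hn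
    _ ≤ 3 := Real.exp_one_lt_three.le

-- Adding `‖windowSum‖ ^ 2` on the left is what lets the bound pass from two halves to their union.
theorem norm_transfer_sub_one_sub_windowSum_add_sq_le {A : ℕ → R} {h : ℝ} {d a : ℕ}
    (hd : d * (3 * h) ≤ 1) (hA : dyadicEnergy A d a ≤ h) :
    ‖transfer A a (2 ^ d) - 1 - windowSum A a (2 ^ d)‖ + ‖windowSum A a (2 ^ d)‖ ^ 2
      ≤ (1 + 3 * h) ^ d * dyadicEnergy A d a := by
  have h0 : 0 ≤ h := (dyadicEnergy_nonneg A d a).trans hA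
  induction d generalizing a with
  | zero => simp [transfer, windowSum, dyadicEnergy]
  | succ d ih =>
    have hd' : d * (3 * h) ≤ 1 := by push_cast at hd; linarith
    have half : ∀ b, dyadicEnergy A d b ≤ h →
        ‖transfer A b (2 ^ d) - 1 - windowSum A b (2 ^ d)‖
          + ‖transfer A b (2 ^ d) - 1 - windowSum A b (2 ^ d)‖ ^ 2 + ‖windowSum A b (2 ^ d)‖ ^ 2
        ≤ (1 + 3 * h) ^ (d + 1) * dyadicEnergy A d b := by
      intro b hb
      have hih := ih hd' hb
      have hsmall : ‖transfer A b (2 ^ d) - 1 - windowSum A b (2 ^ d)‖ ≤ 3 * h := by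
        have hpow := one_add_pow_le_three (by positivity) hd'
        have := mul_le_mul hpow hb (dyadicEnergy_nonneg A d b) (by norm_num)
        linarith [sq_nonneg ‖windowSum A b (2 ^ d)‖]
      rw [pow_succ' (1 + 3 * h), mul_assoc]
      refine le_trans ?_ (mul_le_mul_of_nonneg_left hih (by positivity))
      nlinarith [norm_nonneg (transfer A b (2 ^ d) - 1 - windowSum A b (2 ^ d)),
        mul_nonneg h0 (sq_nonneg ‖windowSum A b (2 ^ d)‖)]
    have hleft := half a ((dyadicEnergy_left_le A d a).trans hA)
    have hright := half (a + 2 ^ d) ((dyadicEnergy_right_le A d a).trans hA)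
    have hunion := norm_mul_sub_one_sub_add_le (transfer A (a + 2 ^ d) (2 ^ d))
      (transfer A a (2 ^ d)) (windowSum A (a + 2 ^ d) (2 ^ d)) (windowSum A a (2 ^ d))
    rw [← transfer_two_pow_succ, ← windowSum_two_pow_succ] at hunion
    have htop : ‖windowSum A a (2 ^ (d + 1))‖ ^ 2
        ≤ (1 + 3 * h) ^ (d + 1) * ‖windowSum A a (2 ^ (d + 1))‖ ^ 2 :=
      le_mul_of_one_le_left (sq_nonneg _) (one_le_pow₀ (by linarith))
    rw [dyadicEnergy, mul_add, mul_add]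
    linarith

theorem norm_transfer_le_of_dyadic_blocks {A : ℕ → R} {c : ℝ} {t : ℕ → ℝ} {k₀ : ℕ}
    (hinit : ∀ n ≤ 2 ^ k₀, ‖transfer A 0 n‖ ≤ Real.exp c) (ht : ∀ k, 0 ≤ t k)
    (hblock : ∀ k ≥ k₀, ∀ m ≤ 2 ^ k, ‖transfer A (2 ^ k) m‖ ≤ Real.exp (t k))
    {k n : ℕ} (hk : k₀ ≤ k) (hn : n ≤ 2 ^ k) :
    ‖transfer A 0 n‖ ≤ Real.exp (c + ∑ j ∈ range k, t j) := by
  induction k, hk using Nat.le_induction generalizing n with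
  | base =>
    exact (hinit n hn).trans
      (Real.exp_le_exp.2 (le_add_of_nonneg_right (sum_nonneg fun j _ => ht j)))
  | succ k hk ih =>
    rw [sum_range_succ, ← add_assoc]
    rcases le_total n (2 ^ k) with hnk | hnk
    · exact (ih hnk).trans (Real.exp_le_exp.2 (le_add_of_nonneg_right (ht k)))
    · obtain ⟨m, rfl⟩ := Nat.exists_eq_add_of_le hnk
      have hm : m ≤ 2 ^ k := by rw [pow_succ] at hn; omega
      rw [transfer_add, zero_add, Real.exp_add, mul_comm (Real.exp _)]
      exact (norm_mul_le _ _).trans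
        (mul_le_mul (hblock k hk m hm) (ih le_rfl) (norm_nonneg _) (Real.exp_pos _).le)

variable [NormOneClass R]

theorem norm_transfer_two_pow_le {A : ℕ → R} {h : ℝ} {d a : ℕ} (hd : (d + 1) * (3 * h) ≤ 1)
    (hA : dyadicEnergy A d a ≤ h) : ‖transfer A a (2 ^ d)‖ ≤ Real.exp (4 * √h) := by
  have h0 : 0 ≤ h := (dyadicEnergy_nonneg A d a).trans hA
  have hd' : d * (3 * h) ≤ 1 := by linarith
  have hlinear : ‖windowSum A a (2 ^ d)‖ ≤ √h :=
    Real.le_sqrt_of_sq_le ((sq_norm_windowSum_le_dyadicEnergy A d a).trans hA)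
  have herror : ‖transfer A a (2 ^ d) - 1 - windowSum A a (2 ^ d)‖ ≤ 3 * √h := by
    have hle_sqrt : h ≤ √h := Real.le_sqrt_of_sq_le (by nlinarith [Nat.cast_nonneg (α := ℝ) d])
    have := mul_le_mul (one_add_pow_le_three (by positivity) hd') hA
      (dyadicEnergy_nonneg A d a) (by norm_num)
    linarith [norm_transfer_sub_one_sub_windowSum_add_sq_le hd' hA,
      sq_nonneg ‖windowSum A a (2 ^ d)‖]
  calc ‖transfer A a (2 ^ d)‖
      = ‖1 + windowSum A a (2 ^ d) + (transfer A a (2 ^ d) - 1 - windowSum A a (2 ^ d))‖ := by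
        congr 1; abel
    _ ≤ ‖(1 : R)‖ + ‖windowSum A a (2 ^ d)‖
        + ‖transfer A a (2 ^ d) - 1 - windowSum A a (2 ^ d)‖ := norm_add₃_le
    _ ≤ 4 * √h + 1 := by rw [norm_one]; linarith
    _ ≤ Real.exp (4 * √h) := Real.add_one_le_exp _

theorem norm_transfer_le_of_le_two_pow {A : ℕ → R} {h : ℝ} {d a n : ℕ}
    (hd : (d + 1) * (3 * h) ≤ 1) (hA : dyadicEnergy A d a ≤ h) (hn : n ≤ 2 ^ d) :
    ‖transfer A a n‖ ≤ Real.exp (4 * ((d + 1) * √h)) := by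
  have h0 : 0 ≤ h := (dyadicEnergy_nonneg A d a).trans hA
  induction d generalizing a n with
  | zero =>
    obtain rfl | rfl : n = 0 ∨ n = 2 ^ 0 := by rw [pow_zero] at hn ⊢; omega
    · rw [transfer, norm_one]
      exact Real.one_le_exp (by positivity)
    · simpa using norm_transfer_two_pow_le hd hA
  | succ d ih =>
    have hd' : (d + 1) * (3 * h) ≤ 1 := by push_cast at hd; linarith
    have hleft := (dyadicEnergy_left_le A d a).trans hA
    have hright := (dyadicEnergy_right_le A d a).trans hA
    push_cast
    rcases le_total n (2 ^ d) with hnd | hnd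
    · refine (ih hd' hleft hnd).trans ?_
      gcongr
      linarith
    · obtain ⟨m, rfl⟩ := Nat.exists_eq_add_of_le hnd
      have hm : m ≤ 2 ^ d := by rw [pow_succ] at hn; omega
      calc ‖transfer A a (2 ^ d + m)‖
          ≤ ‖transfer A (a + 2 ^ d) m‖ * ‖transfer A a (2 ^ d)‖ := by
            rw [transfer_add]; exact norm_mul_le _ _
        _ ≤ Real.exp (4 * ((d + 1) * √h)) * Real.exp (4 * √h) := by
            gcongr
            exacts [ih hd' hright hm, norm_transfer_two_pow_le hd' hleft]
        _ = Real.exp (4 * ((d + 1 + 1) * √h)) := by rw [← Real.exp_add]; ring_nf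

theorem norm_transfer_le_exp_windowSum_norm (A : ℕ → R) (a n : ℕ) :
    ‖transfer A a n‖ ≤ Real.exp (windowSum (fun j => ‖A j‖) a n) := by
  induction n with
  | zero => simp [transfer, windowSum]
  | succ n ih =>
    have hfactor : ‖1 + A (a + n)‖ ≤ Real.exp ‖A (a + n)‖ := by
      refine (norm_add_le _ _).trans ?_
      rw [norm_one, add_comm]
      exact Real.add_one_le_exp _
    rw [transfer, windowSum, sum_range_succ, Real.exp_add, mul_comm (Real.exp _)]
    exact (norm_mul_le _ _).trans (mul_le_mul hfactor ih (norm_nonneg _) (Real.exp_pos _).le)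

theorem norm_transfer_le_of_summable {A : ℕ → R} {k₀ : ℕ}
    (hsmall : ∀ k ≥ k₀, (k + 1) * (3 * dyadicEnergy A k (2 ^ k)) ≤ 1)
    (hsum : Summable fun k : ℕ => (k + 1) * √(dyadicEnergy A k (2 ^ k))) (n : ℕ) :
    ‖transfer A 0 n‖ ≤ Real.exp (∑ j ∈ range (2 ^ k₀), ‖A j‖
      + ∑' k : ℕ, 4 * ((k + 1) * √(dyadicEnergy A k (2 ^ k)))) := by
  have hinit : ∀ n ≤ 2 ^ k₀, ‖transfer A 0 n‖ ≤ Real.exp (∑ j ∈ range (2 ^ k₀), ‖A j‖) := by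
    intro n hn
    refine (norm_transfer_le_exp_windowSum_norm A 0 n).trans (Real.exp_le_exp.2 ?_)
    simp only [windowSum, zero_add]
    exact sum_le_sum_of_subset_of_nonneg (range_mono hn) fun _ _ _ => norm_nonneg _
  have hn : n ≤ 2 ^ max k₀ n :=
    Nat.lt_two_pow_self.le.trans (Nat.pow_le_pow_right two_pos (le_max_right _ _))
  refine (norm_transfer_le_of_dyadic_blocks hinit (fun k => by positivity)
    (fun k hk m hm => norm_transfer_le_of_le_two_pow (hsmall k hk) le_rfl hm)
    (le_max_left _ _) hn).trans ?_
  gcongr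
  exact (hsum.mul_left 4).sum_le_tsum _ fun k _ => by positivity

theorem exists_forall_ge_mul_dyadicEnergy_le_one {E : Type*} [SeminormedAddCommGroup E]
    {B : ℕ → E} (hB : Summable fun k : ℕ => (k + 1) * √(dyadicEnergy B k (2 ^ k))) :
    ∃ k₀ : ℕ, ∀ k ≥ k₀, (k + 1) * (3 * dyadicEnergy B k (2 ^ k)) ≤ 1 := by
  have hev := hB.tendsto_atTop_zero.eventually_le_const (show (0 : ℝ) < 1 / 2 by norm_num)
  refine Filter.eventually_atTop.1 (hev.mono fun k hk => ?_)
  have hsq : √(dyadicEnergy B k (2 ^ k)) ^ 2 = dyadicEnergy B k (2 ^ k) :=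
    Real.sq_sqrt (dyadicEnergy_nonneg ..)
  have hsqrt := Real.sqrt_nonneg (dyadicEnergy B k (2 ^ k))
  have hk0 : (0 : ℝ) ≤ k := Nat.cast_nonneg k
  have hle : √(dyadicEnergy B k (2 ^ k)) ≤ 1 / 2 := by nlinarith [hk0]
  nlinarith

theorem exists_forall_norm_transfer_le (R : Type*) [NormedRing R] [NormOneClass R]
    {E : Type*} [SeminormedAddCommGroup E] {B : ℕ → E}
    (hB : Summable fun k : ℕ => (k + 1) * √(dyadicEnergy B k (2 ^ k))) :
    ∃ C : ℝ, ∀ A : ℕ → R, (∀ a n, ‖windowSum A a n‖ = ‖windowSum B a n‖) →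
      ∀ n, ‖transfer A 0 n‖ ≤ C := by
  obtain ⟨k₀, hk₀⟩ := exists_forall_ge_mul_dyadicEnergy_le_one hB
  refine ⟨Real.exp (∑ j ∈ range (2 ^ k₀), ‖B j‖
    + ∑' k : ℕ, 4 * ((k + 1) * √(dyadicEnergy B k (2 ^ k)))), fun A hAB n => ?_⟩
  simp only [← dyadicEnergy_congr hAB] at hB hk₀ ⊢
  simpa only [norm_eq_of_norm_windowSum_eq hAB] using norm_transfer_le_of_summable hk₀ hB n

end NormTransfer

/-! ### Polynomials on the unit circle -/

section UnitCircle

variable {P : ℂ[X]} {L : ℕ}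

theorem integral_sq_norm_eval_exp_I_mul (hP : P.degree < L) :
    ∫ x in (0 : ℝ)..2 * π, ‖P.eval (Complex.exp (Complex.I * x))‖ ^ 2
      = 2 * π * ∑ k ∈ range L, ‖P.coeff k‖ ^ 2 := by
  have hsupport : ∑ k ∈ P.support, ‖P.coeff k‖ ^ 2 = ∑ k ∈ range L, ‖P.coeff k‖ ^ 2 := by
    refine sum_subset (fun k hk => ?_) fun k _ hk => by simp [notMem_support_iff.1 hk]
    by_contra hkL
    exact mem_support_iff.1 hk ((degree_lt_iff_coeff_zero _ _).1 hP k (by simpa using hkL))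
  have hparseval := P.sum_sq_norm_coeff_eq_circleAverage
  rw [hsupport, Real.circleAverage_def, smul_eq_mul] at hparseval
  rw [hparseval, mul_inv_cancel_left₀ (by positivity)]
  simp [circleMap, mul_comm Complex.I]

theorem degree_X_mul_derivative_lt (hP : P.degree < L) : degree (X * derivative P) < L := by
  rw [degree_lt_iff_coeff_zero] at hP ⊢
  rintro (_ | k) hk
  · simp
  · rw [coeff_X_mul, coeff_derivative, hP _ hk, zero_mul]

theorem sum_sq_norm_coeff_X_mul_derivative_le (P : ℂ[X]) (L : ℕ) :
    ∑ k ∈ range L, ‖(X * derivative P).coeff k‖ ^ 2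
      ≤ L ^ 2 * ∑ k ∈ range L, ‖P.coeff k‖ ^ 2 := by
  rw [mul_sum]
  refine sum_le_sum fun k hk => ?_
  have hkL : (k : ℝ) ≤ L := Nat.cast_le.2 (mem_range.1 hk).le
  have hcoeff : ‖(X * derivative P).coeff k‖ = k * ‖P.coeff k‖ := by
    cases k with
    | zero => simp
    | succ k =>
      rw [coeff_X_mul, coeff_derivative, norm_mul, mul_comm]
      exact_mod_cast congrArg (· * _) (Complex.norm_natCast (k + 1))
  rw [hcoeff, mul_pow]
  gcongr

theorem hasDerivAt_eval_exp_I_mul (P : ℂ[X]) (x : ℝ) :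
    HasDerivAt (fun x : ℝ => P.eval (Complex.exp (Complex.I * x)))
      (Complex.I * (X * derivative P).eval (Complex.exp (Complex.I * x))) x := by
  have hexp : HasDerivAt (fun x : ℝ => Complex.exp (Complex.I * x))
      (Complex.exp (Complex.I * x) * (Complex.I * 1)) x :=
    ((hasDerivAt_id (x : ℂ)).const_mul Complex.I).cexp.comp_ofReal
  refine ((P.hasDerivAt _).scomp x hexp).congr_deriv ?_
  simp only [eval_mul, eval_X, smul_eq_mul]
  ring

theorem continuous_eval_exp_I_mul (P : ℂ[X]) :
    Continuous fun x : ℝ => P.eval (Complex.exp (Complex.I * x)) := by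
  fun_prop

theorem integral_abs_deriv_sq_norm_eval_exp_I_mul_le (hP : P.degree < L) :
    ∫ x in (0 : ℝ)..2 * π, |2 * inner ℝ (P.eval (Complex.exp (Complex.I * x)))
        (Complex.I * (X * derivative P).eval (Complex.exp (Complex.I * x)))|
      ≤ 4 * π * L * ∑ k ∈ range L, ‖P.coeff k‖ ^ 2 := by
  rcases L.eq_zero_or_pos with rfl | hL
  · obtain rfl : P = 0 := by simpa using hP
    simp
  set f : ℝ → ℂ := fun x => P.eval (Complex.exp (Complex.I * x))
  set f' : ℝ → ℂ := fun x => (X * derivative P).eval (Complex.exp (Complex.I * x))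
  have hf : Continuous f := continuous_eval_exp_I_mul P
  have hf' : Continuous f' := continuous_eval_exp_I_mul _
  have hpointwise : ∀ x, |2 * inner ℝ (f x) (Complex.I * f' x)|
      ≤ L * ‖f x‖ ^ 2 + (L : ℝ)⁻¹ * ‖f' x‖ ^ 2 := by
    intro x
    have hinner := abs_real_inner_le_norm (f x) (Complex.I * f' x)
    rw [norm_mul, Complex.norm_I, one_mul] at hinner
    rw [abs_mul, abs_two]
    linarith [two_mul_le_add_mul_sq (a := ‖f x‖) (b := ‖f' x‖) (ε := L) (by positivity)]
  calc ∫ x in (0 : ℝ)..2 * π, |2 * inner ℝ (f x) (Complex.I * f' x)|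
      ≤ ∫ x in (0 : ℝ)..2 * π, (L * ‖f x‖ ^ 2 + (L : ℝ)⁻¹ * ‖f' x‖ ^ 2) :=
        intervalIntegral.integral_mono_on (by positivity)
          (Continuous.intervalIntegrable (by fun_prop) _ _)
          (Continuous.intervalIntegrable (by fun_prop) _ _) fun x _ => hpointwise x
    _ = L * (2 * π * ∑ k ∈ range L, ‖P.coeff k‖ ^ 2)
        + (L : ℝ)⁻¹ * (2 * π * ∑ k ∈ range L, ‖(X * derivative P).coeff k‖ ^ 2) := by
        rw [intervalIntegral.integral_add (Continuous.intervalIntegrable (by fun_prop) _ _)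
          (Continuous.intervalIntegrable (by fun_prop) _ _), intervalIntegral.integral_const_mul,
          intervalIntegral.integral_const_mul, integral_sq_norm_eval_exp_I_mul hP,
          integral_sq_norm_eval_exp_I_mul (degree_X_mul_derivative_lt hP)]
    _ ≤ L * (2 * π * ∑ k ∈ range L, ‖P.coeff k‖ ^ 2)
        + (L : ℝ)⁻¹ * (2 * π * (L ^ 2 * ∑ k ∈ range L, ‖P.coeff k‖ ^ 2)) := by
        gcongr
        exact sum_sq_norm_coeff_X_mul_derivative_le P L
    _ = 4 * π * L * ∑ k ∈ range L, ‖P.coeff k‖ ^ 2 := by field_simp; ring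

end UnitCircle

/-! ### Integration against Hölder measures -/

section Sobolev

variable {g g' : ℝ → ℝ} {a b x y : ℝ}

theorem sub_le_integral_abs_deriv (hg : ∀ t ∈ Set.Icc a b, HasDerivAt g (g' t) t)
    (hg' : IntervalIntegrable g' volume a b) (hx : x ∈ Set.Icc a b) (hy : y ∈ Set.Icc a b) :
    g x - g y ≤ ∫ t in a..b, |g' t| := by
  have hab : a ≤ b := hx.1.trans hx.2
  have hsub : Set.uIcc y x ⊆ Set.Icc a b := Set.ordConnected_Icc.uIcc_subset hy hx
  calc g x - g y = ∫ t in y..x, g' t := by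
        refine (intervalIntegral.integral_eq_sub_of_hasDerivAt (fun t ht => hg t (hsub ht))
          (hg'.mono_set ?_)).symm
        rwa [Set.uIcc_of_le hab]
    _ ≤ |(∫ t in y..x, |g' t|)| :=
        (Real.le_norm_self _).trans intervalIntegral.norm_integral_le_abs_integral_norm
    _ ≤ |(∫ t in a..b, |g' t|)| := by
        refine intervalIntegral.abs_integral_mono_interval ?_ (ae_of_all _ fun t => abs_nonneg _)
          hg'.abs
        rw [Set.uIoc_of_le hab]
        exact Set.Ioc_subset_Ioc (le_min hy.1 hx.1) (max_le hy.2 hx.2)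
    _ = ∫ t in a..b, |g' t| :=
        abs_of_nonneg (intervalIntegral.integral_nonneg hab fun t _ => abs_nonneg _)

theorem le_average_add_integral_abs_deriv (hab : a < b)
    (hg : ∀ t ∈ Set.Icc a b, HasDerivAt g (g' t) t) (hg' : IntervalIntegrable g' volume a b)
    (hx : x ∈ Set.Icc a b) :
    g x ≤ (b - a)⁻¹ * (∫ t in a..b, g t) + ∫ t in a..b, |g' t| := by
  have hgint : IntervalIntegrable g volume a b :=
    ContinuousOn.intervalIntegrable_of_Icc hab.le fun t ht =>
      (hg t ht).continuousAt.continuousWithinAt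
  have hmono := intervalIntegral.integral_mono_on hab.le intervalIntegrable_const hgint
    fun y hy => sub_le_comm.1 (sub_le_integral_abs_deriv hg hg' hx hy)
  rw [intervalIntegral.integral_const, smul_eq_mul] at hmono
  linarith [(le_inv_mul_iff₀ (sub_pos.2 hab)).2 hmono]

variable {ν : Measure ℝ} {m : ℝ}

theorem setLIntegral_ofReal_le_of_measure_le (hab : a < b)
    (hg : ∀ t ∈ Set.Icc a b, HasDerivAt g (g' t) t) (hg' : IntervalIntegrable g' volume a b)
    (hg0 : ∀ t ∈ Set.Icc a b, 0 ≤ g t) (hν : ν (Set.Ioc a b) ≤ ENNReal.ofReal m) :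
    ∫⁻ x in Set.Ioc a b, ENNReal.ofReal (g x) ∂ν
      ≤ ENNReal.ofReal (m * ((b - a)⁻¹ * (∫ t in a..b, g t) + ∫ t in a..b, |g' t|)) := by
  set S := (b - a)⁻¹ * (∫ t in a..b, g t) + ∫ t in a..b, |g' t|
  have hsup : ∀ x ∈ Set.Ioc a b, g x ≤ S := fun x hx =>
    le_average_add_integral_abs_deriv hab hg hg' (Set.Ioc_subset_Icc_self hx)
  have hS : 0 ≤ S := (hg0 b (Set.right_mem_Icc.2 hab.le)).trans
    (hsup b (Set.right_mem_Ioc.2 hab))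
  calc ∫⁻ x in Set.Ioc a b, ENNReal.ofReal (g x) ∂ν
      ≤ ∫⁻ _ in Set.Ioc a b, ENNReal.ofReal S ∂ν :=
        setLIntegral_mono measurable_const fun x hx => ENNReal.ofReal_le_ofReal (hsup x hx)
    _ = ν (Set.Ioc a b) * ENNReal.ofReal S := by rw [setLIntegral_const, mul_comm]
    _ ≤ ENNReal.ofReal m * ENNReal.ofReal S := by gcongr
    _ = ENNReal.ofReal (m * S) := (ENNReal.ofReal_mul' hS).symm

theorem lintegral_ofReal_le_of_forall_measure_Ioc_le {ℓ : ℝ} {L : ℕ} (hℓ : 0 < ℓ)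
    (hg : ∀ t, HasDerivAt g (g' t) t) (hg' : Continuous g') (hg0 : ∀ t, 0 ≤ g t) (hm : 0 ≤ m)
    (hsupp : ∀ᵐ x ∂ν, x ∈ Set.Ioc 0 (ℓ * L))
    (hν : ∀ j < L, ν (Set.Ioc (ℓ * j) (ℓ * (j + 1 : ℕ))) ≤ ENNReal.ofReal m) :
    ∫⁻ x, ENNReal.ofReal (g x) ∂ν ≤ ENNReal.ofReal (m *
      (ℓ⁻¹ * (∫ t in (0 : ℝ)..ℓ * L, g t) + ∫ t in (0 : ℝ)..ℓ * L, |g' t|)) := by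
  have hgc : Continuous g := continuous_iff_continuousAt.2 fun t => (hg t).continuousAt
  have hmono : Monotone fun j : ℕ => ℓ * (j : ℝ) := fun i j hij => by dsimp only; gcongr
  have hlt : ∀ j : ℕ, ℓ * (j : ℝ) < ℓ * (j + 1 : ℕ) := fun j => by gcongr; simp
  have hlen : ∀ j : ℕ, ℓ * (j + 1 : ℕ) - ℓ * (j : ℝ) = ℓ := fun j => by push_cast; ring
  have hcover : ⋃ j ∈ range L, Set.Ioc (ℓ * (j : ℝ)) (ℓ * (j + 1 : ℕ)) = Set.Ioc 0 (ℓ * L) := by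
    simpa using hmono.biUnion_Ico_Ioc_map_succ 0 L
  set S : ℕ → ℝ := fun j => ℓ⁻¹ * (∫ t in ℓ * j..ℓ * (j + 1 : ℕ), g t)
    + ∫ t in ℓ * j..ℓ * (j + 1 : ℕ), |g' t|
  have hS0 : ∀ j, 0 ≤ S j := fun j => add_nonneg
    (mul_nonneg (by positivity) (intervalIntegral.integral_nonneg (hlt j).le fun t _ => hg0 t))
    (intervalIntegral.integral_nonneg (hlt j).le fun t _ => abs_nonneg _)
  have hsum : ∑ j ∈ range L, S j
      = ℓ⁻¹ * (∫ t in (0 : ℝ)..ℓ * L, g t) + ∫ t in (0 : ℝ)..ℓ * L, |g' t| := by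
    rw [sum_add_distrib, ← mul_sum, intervalIntegral.sum_integral_adjacent_intervals
      (a := fun j : ℕ => ℓ * (j : ℝ)) fun j _ => hgc.intervalIntegrable _ _,
      intervalIntegral.sum_integral_adjacent_intervals
      (a := fun j : ℕ => ℓ * (j : ℝ)) fun j _ => hg'.abs.intervalIntegrable _ _]
    simp
  have hdisj : Set.PairwiseDisjoint (range L : Set ℕ)
      fun j => Set.Ioc (ℓ * (j : ℝ)) (ℓ * (j + 1 : ℕ)) :=
    hmono.pairwise_disjoint_on_Ioc_succ.set_pairwise _
  rw [← hsum, ← Measure.restrict_eq_self_of_ae_mem hsupp, ← hcover,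
    lintegral_biUnion_finset hdisj fun j _ => measurableSet_Ioc, mul_sum,
    ENNReal.ofReal_sum_of_nonneg fun j _ => mul_nonneg hm (hS0 j)]
  refine sum_le_sum fun j hj => ?_
  simpa only [hlen] using setLIntegral_ofReal_le_of_measure_le (hlt j) (fun t _ => hg t)
    (hg'.intervalIntegrable _ _) (fun t _ => hg0 t) (hν j (mem_range.1 hj))

end Sobolev

section Holder

variable {ν : Measure ℝ} {D : ℝ}

theorem UniformlyHolder.exists_measure_Ioc_le (hν : UniformlyHolder ν D) (hD : 0 ≤ D)
    (hsupp : ∀ᵐ x ∂ν, x ∈ Set.Ioo 0 (2 * π)) :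
    ∃ K : ℝ, 0 ≤ K ∧ ∀ a b : ℝ, a ≤ b → ν (Set.Ioc a b) ≤ ENNReal.ofReal (K * (b - a) ^ D) := by
  obtain ⟨K, hK⟩ := hν
  refine ⟨K, K.coe_nonneg, fun a b hab => ?_⟩
  calc ν (Set.Ioc a b) = ν (Set.Ioc a b ∩ Set.Ioo 0 (2 * π)) :=
        (measure_inter_conull hsupp).symm
    _ ≤ K * volume (Set.Ioc a b ∩ Set.Ioo 0 (2 * π)) ^ D :=
        hK _ (Set.ordConnected_Ioc.inter Set.ordConnected_Ioo) Set.inter_subset_right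
    _ ≤ K * ENNReal.ofReal (b - a) ^ D := by
        gcongr
        rw [← Real.volume_Ioc]
        exact measure_mono Set.inter_subset_left
    _ = ENNReal.ofReal (K * (b - a) ^ D) := by
        rw [ENNReal.ofReal_mul K.coe_nonneg, ENNReal.ofReal_coe_nnreal,
          ENNReal.ofReal_rpow_of_nonneg (sub_nonneg.2 hab) hD]

theorem UniformlyHolder.exists_lintegral_sq_norm_eval_le (hν : UniformlyHolder ν D) (hD : 0 ≤ D)
    (hsupp : ∀ᵐ x ∂ν, x ∈ Set.Ioo 0 (2 * π)) :
    ∃ M : ℝ, 0 ≤ M ∧ ∀ (P : ℂ[X]) (L : ℕ), P.degree < L →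
      ∫⁻ x, ENNReal.ofReal (‖P.eval (Complex.exp (Complex.I * x))‖ ^ 2) ∂ν
        ≤ ENNReal.ofReal (M * L ^ (1 - D) * ∑ k ∈ range L, ‖P.coeff k‖ ^ 2) := by
  obtain ⟨K, hK0, hK⟩ := hν.exists_measure_Ioc_le hD hsupp
  refine ⟨K * (2 * π) ^ D * (1 + 4 * π), by positivity, fun P L hP => ?_⟩
  rcases L.eq_zero_or_pos with rfl | hL
  · obtain rfl : P = 0 := by simpa using hP
    simp
  have hL' : (0 : ℝ) < L := Nat.cast_pos.2 hL
  have hend : 2 * π / L * L = 2 * π := div_mul_cancel₀ _ hL'.ne'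
  have hder := fun t => (hasDerivAt_eval_exp_I_mul P t).norm_sq
  have hder_cont : Continuous fun x : ℝ => 2 * inner ℝ (P.eval (Complex.exp (Complex.I * x)))
      (Complex.I * (X * derivative P).eval (Complex.exp (Complex.I * x))) :=
    continuous_const.mul ((continuous_eval_exp_I_mul P).inner
      (continuous_const.mul (continuous_eval_exp_I_mul _)))
  have hcell : ∀ j < L, ν (Set.Ioc (2 * π / L * j) (2 * π / L * (j + 1 : ℕ)))
      ≤ ENNReal.ofReal (K * (2 * π / L) ^ D) := by
    intro j _
    have hlen : 2 * π / L * (j + 1 : ℕ) - 2 * π / L * j = 2 * π / L := by push_cast; ring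
    simpa only [hlen] using hK (2 * π / L * j) (2 * π / L * (j + 1 : ℕ)) (by gcongr; simp)
  have hcells := lintegral_ofReal_le_of_forall_measure_Ioc_le (L := L) (by positivity) hder
    hder_cont (fun _ => sq_nonneg _) (by positivity)
    (hsupp.mono fun x hx => by rw [hend]; exact Set.Ioo_subset_Ioc_self hx) hcell
  rw [hend, integral_sq_norm_eval_exp_I_mul hP] at hcells
  refine hcells.trans (ENNReal.ofReal_le_ofReal ?_)
  calc _ ≤ K * (2 * π / L) ^ D * ((2 * π / L)⁻¹ * (2 * π * ∑ k ∈ range L, ‖P.coeff k‖ ^ 2)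
          + 4 * π * L * ∑ k ∈ range L, ‖P.coeff k‖ ^ 2) := by
        gcongr
        exact integral_abs_deriv_sq_norm_eval_exp_I_mul_le hP
    _ = _ := by
        rw [Real.div_rpow (by positivity) hL'.le, Real.rpow_sub hL', Real.rpow_one]
        field_simp

end Holder

/-! ### Almost sure decay of the dyadic energies -/

section DyadicEnergyIntegral

variable {X E : Type*} [MeasurableSpace X] [NormedAddCommGroup E]

theorem stronglyMeasurable_windowSum {A : X → ℕ → E}
    (hA : ∀ n, StronglyMeasurable fun x => A x n) (a n : ℕ) :
    StronglyMeasurable fun x => windowSum (A x) a n :=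
  Finset.stronglyMeasurable_fun_sum _ fun _ _ => hA _

theorem measurable_dyadicEnergy {A : X → ℕ → E} (hA : ∀ n, StronglyMeasurable fun x => A x n)
    (d a : ℕ) : Measurable fun x => dyadicEnergy (A x) d a := by
  induction d generalizing a with
  | zero => exact (stronglyMeasurable_windowSum hA a 1).norm.measurable.pow_const 2
  | succ d ih =>
    exact ((stronglyMeasurable_windowSum hA a _).norm.measurable.pow_const 2).add
      ((ih a).add (ih _))

theorem lintegral_dyadicEnergy_le {μ : Measure X} {A : X → ℕ → E}
    (hA : ∀ n, StronglyMeasurable fun x => A x n) {w : ℕ → ENNReal} {d : ℕ}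
    (hw : ∀ j ≤ d, ∀ b, ∫⁻ x, ENNReal.ofReal (‖windowSum (A x) b (2 ^ j)‖ ^ 2) ∂μ
      ≤ windowSum w b (2 ^ j)) (a : ℕ) :
    ∫⁻ x, ENNReal.ofReal (dyadicEnergy (A x) d a) ∂μ ≤ (d + 1) * windowSum w a (2 ^ d) := by
  induction d generalizing a with
  | zero => simpa [dyadicEnergy] using hw 0 le_rfl a
  | succ d ih =>
    have ih' := ih fun j hj => hw j (hj.trans d.le_succ)
    have hsq_meas : Measurable fun x =>
        ENNReal.ofReal (‖windowSum (A x) a (2 ^ (d + 1))‖ ^ 2) :=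
      ((stronglyMeasurable_windowSum hA a _).norm.measurable.pow_const 2).ennreal_ofReal
    calc ∫⁻ x, ENNReal.ofReal (dyadicEnergy (A x) (d + 1) a) ∂μ
        = ∫⁻ x, ENNReal.ofReal (‖windowSum (A x) a (2 ^ (d + 1))‖ ^ 2) ∂μ
          + (∫⁻ x, ENNReal.ofReal (dyadicEnergy (A x) d a) ∂μ
            + ∫⁻ x, ENNReal.ofReal (dyadicEnergy (A x) d (a + 2 ^ d)) ∂μ) := by
          rw [← lintegral_add_left (measurable_dyadicEnergy hA d a).ennreal_ofReal,
            ← lintegral_add_left hsq_meas]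
          congr with x
          rw [dyadicEnergy, ENNReal.ofReal_add (sq_nonneg _)
            (add_nonneg (dyadicEnergy_nonneg ..) (dyadicEnergy_nonneg ..)),
            ENNReal.ofReal_add (dyadicEnergy_nonneg ..) (dyadicEnergy_nonneg ..)]
      _ ≤ windowSum w a (2 ^ (d + 1)) + ((d + 1) * windowSum w a (2 ^ d)
          + (d + 1) * windowSum w (a + 2 ^ d) (2 ^ d)) := by
          gcongr
          exacts [hw _ le_rfl a, ih' a, ih' _]
      _ = ((d + 1 : ℕ) + 1) * windowSum w a (2 ^ (d + 1)) := by
          rw [windowSum_two_pow_succ]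
          push_cast
          ring

end DyadicEnergyIntegral

section Summability

variable {X : Type*} [MeasurableSpace X] {μ : Measure X} {f : ℕ → X → ℝ}

theorem ae_summable_of_lintegral_le (hf : ∀ k, Measurable (f k)) (hf0 : ∀ k x, 0 ≤ f k x)
    {u : ℕ → ℝ} (hu : Summable u)
    (hint : ∀ k, ∫⁻ x, ENNReal.ofReal (f k x) ∂μ ≤ ENNReal.ofReal (u k)) :
    ∀ᵐ x ∂μ, Summable fun k => f k x := by
  have hfin : ∫⁻ x, ∑' k, ENNReal.ofReal (f k x) ∂μ ≠ ⊤ := by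
    rw [lintegral_tsum fun k => (hf k).ennreal_ofReal.aemeasurable]
    exact ne_top_of_le_ne_top hu.tsum_ofReal_ne_top (ENNReal.tsum_le_tsum hint)
  filter_upwards [ae_lt_top (Measurable.tsum fun k => (hf k).ennreal_ofReal) hfin]
    with x hx
  simpa only [ENNReal.toReal_ofReal (hf0 _ x)] using ENNReal.summable_toReal hx.ne

theorem summable_add_one_pow_mul_geometric {s : ℝ} (hs0 : 0 < s) (hs1 : s < 1) (p : ℕ) :
    Summable fun k : ℕ => ((k : ℝ) + 1) ^ p * s ^ k := by
  have hpow : Summable fun k : ℕ => (k : ℝ) ^ p * s ^ k :=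
    summable_pow_mul_geometric_of_norm_lt_one p (by rwa [Real.norm_of_nonneg hs0.le])
  refine (((summable_nat_add_iff 1).2 hpow).mul_right s⁻¹).congr fun k => ?_
  rw [pow_succ, ← mul_assoc, mul_inv_cancel_right₀ hs0.ne', Nat.cast_succ]

theorem ae_summable_mul_sqrt_of_lintegral_le_geometric (hf : ∀ k, Measurable (f k))
    (hf0 : ∀ k x, 0 ≤ f k x) {M r : ℝ} (hr0 : 0 < r) (hr1 : r < 1)
    (hint : ∀ k : ℕ, ∫⁻ x, ENNReal.ofReal (f k x) ∂μ
      ≤ ENNReal.ofReal (M * ((k + 1) * r ^ k))) :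
    ∀ᵐ x ∂μ, Summable fun k : ℕ => (k + 1) * √(f k x) := by
  have hs0 : 0 < √r := Real.sqrt_pos.2 hr0
  have hs1 : √r < 1 := by rwa [Real.sqrt_lt' one_pos, one_pow]
  have hweighted : ∀ k : ℕ, ∫⁻ x, ENNReal.ofReal ((√r ^ k)⁻¹ * f k x) ∂μ
      ≤ ENNReal.ofReal (M * (((k : ℝ) + 1) ^ 1 * √r ^ k)) := by
    intro k
    have hsplit : r ^ k = √r ^ k * √r ^ k := by rw [← mul_pow, Real.mul_self_sqrt hr0.le]
    simp only [ENNReal.ofReal_mul (inv_nonneg.2 (pow_nonneg hs0.le k))]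
    rw [lintegral_const_mul _ (hf k).ennreal_ofReal]
    refine (mul_le_mul_right (hint k) _).trans_eq ?_
    rw [← ENNReal.ofReal_mul (by positivity), hsplit]
    congr 1
    field_simp
  filter_upwards [ae_summable_of_lintegral_le (fun k => (hf k).const_mul _)
    (fun k x => mul_nonneg (by positivity) (hf0 k x))
    ((summable_add_one_pow_mul_geometric hs0 hs1 1).mul_left M) hweighted] with x hx
  refine Summable.of_nonneg_of_le (fun k => by positivity) (fun k => ?_)
    ((summable_add_one_pow_mul_geometric hs0 hs1 2).add hx)
  have hamgm := two_mul_le_add_mul_sq (a := (k : ℝ) + 1) (b := √(f k x)) (pow_pos hs0 k)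
  rw [Real.sq_sqrt (hf0 k x)] at hamgm
  have : 0 ≤ (k + 1) * √(f k x) := by positivity
  linarith

end Summability

/-- The sequence `α n * z ^ n`, whose window sums carry all cancellation in the Szegő recurrence at
a point `z` of the unit circle. -/
def modulated (α : ℕ → ℂ) (z : ℂ) (n : ℕ) : ℂ :=
  α n * z ^ n

/-- The polynomial of degree less than `L` with coefficients `α a, …, α (a + L - 1)`; up to the
factor `z ^ a` its values are the window sums of `modulated α z`. -/
noncomputable def windowPoly (α : ℕ → ℂ) (a L : ℕ) : ℂ[X] :=
  ∑ k ∈ range L, monomial k (α (a + k))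

theorem coeff_windowPoly (α : ℕ → ℂ) (a L k : ℕ) :
    (windowPoly α a L).coeff k = if k < L then α (a + k) else 0 := by
  simp [windowPoly, coeff_monomial]

theorem degree_windowPoly_lt (α : ℕ → ℂ) (a L : ℕ) : (windowPoly α a L).degree < L :=
  (degree_lt_iff_coeff_zero _ _).2 fun k hk => by rw [coeff_windowPoly, if_neg hk.not_gt]

theorem windowSum_modulated (α : ℕ → ℂ) (z : ℂ) (a L : ℕ) :
    windowSum (modulated α z) a L = z ^ a * (windowPoly α a L).eval z := by
  simp only [windowSum, modulated, windowPoly, eval_finsetSum, eval_monomial, mul_sum, pow_add]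
  exact sum_congr rfl fun k _ => mul_left_comm _ _ _

theorem windowSum_sq_norm_le_rpow_neg_mul_tsum {E : Type*} [SeminormedAddCommGroup E]
    {α : ℕ → E} {γ : ℝ} (hγ : 0 ≤ γ) (hdecay : Summable fun n : ℕ => (n : ℝ) ^ γ * ‖α n‖ ^ 2)
    {a : ℕ} (ha : 0 < a) (n : ℕ) :
    windowSum (fun n => ‖α n‖ ^ 2) a n
      ≤ (a : ℝ) ^ (-γ) * ∑' n : ℕ, (n : ℝ) ^ γ * ‖α n‖ ^ 2 := by
  have ha' : (0 : ℝ) < a := Nat.cast_pos.2 ha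
  have htail : ∑ i ∈ range n, ((a + i : ℕ) : ℝ) ^ γ * ‖α (a + i)‖ ^ 2
      ≤ ∑' n : ℕ, (n : ℝ) ^ γ * ‖α n‖ ^ 2 := by
    simpa only [sum_map, addLeftEmbedding_apply] using
      hdecay.sum_le_tsum ((range n).map (addLeftEmbedding a)) fun i _ => by positivity
  rw [Real.rpow_neg ha'.le, le_inv_mul_iff₀ (by positivity), windowSum, mul_sum]
  refine le_trans (sum_le_sum fun i _ => ?_) htail
  gcongr
  exact Nat.le_add_right a i

section Holder

variable {ν : Measure ℝ} {D : ℝ}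

theorem UniformlyHolder.exists_lintegral_sq_norm_windowSum_le (hν : UniformlyHolder ν D)
    (hD : 0 ≤ D) (hsupp : ∀ᵐ x ∂ν, x ∈ Set.Ioo 0 (2 * π)) :
    ∃ M : ℝ, 0 ≤ M ∧ ∀ (α : ℕ → ℂ) (a L : ℕ), ∫⁻ η, ENNReal.ofReal
        (‖windowSum (modulated α (Complex.exp (Complex.I * η))) a L‖ ^ 2) ∂ν
      ≤ ENNReal.ofReal (M * L ^ (1 - D) * windowSum (fun n => ‖α n‖ ^ 2) a L) := by
  obtain ⟨M, hM0, hM⟩ := hν.exists_lintegral_sq_norm_eval_le hD hsupp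
  refine ⟨M, hM0, fun α a L => ?_⟩
  have hcoeff : ∑ k ∈ range L, ‖(windowPoly α a L).coeff k‖ ^ 2
      = windowSum (fun n => ‖α n‖ ^ 2) a L :=
    sum_congr rfl fun k hk => by rw [coeff_windowPoly, if_pos (mem_range.1 hk)]
  simpa only [windowSum_modulated, norm_mul, norm_pow, Complex.norm_exp_I_mul_ofReal, one_pow,
    one_mul, hcoeff] using hM (windowPoly α a L) L (degree_windowPoly_lt α a L)

theorem stronglyMeasurable_modulated_exp (α : ℕ → ℂ) (n : ℕ) :
    StronglyMeasurable fun η : ℝ => modulated α (Complex.exp (Complex.I * η)) n :=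
  Continuous.stronglyMeasurable (by unfold modulated; fun_prop)

theorem UniformlyHolder.exists_lintegral_dyadicEnergy_le (hν : UniformlyHolder ν D)
    (hD0 : 0 ≤ D) (hD1 : D ≤ 1) (hsupp : ∀ᵐ x ∂ν, x ∈ Set.Ioo 0 (2 * π)) :
    ∃ M : ℝ, 0 ≤ M ∧ ∀ (α : ℕ → ℂ) (d a : ℕ), ∫⁻ η, ENNReal.ofReal
        (dyadicEnergy (modulated α (Complex.exp (Complex.I * η))) d a) ∂ν
      ≤ ENNReal.ofReal (M * ((d + 1) * ((2 ^ d) ^ (1 - D)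
        * windowSum (fun n => ‖α n‖ ^ 2) a (2 ^ d)))) := by
  obtain ⟨M, hM0, hM⟩ := hν.exists_lintegral_sq_norm_windowSum_le hD0 hsupp
  refine ⟨M, hM0, fun α d a => ?_⟩
  have hweight : ∀ b n, windowSum (fun n => ENNReal.ofReal (M * (2 ^ d) ^ (1 - D) * ‖α n‖ ^ 2)) b n
      = ENNReal.ofReal (M * (2 ^ d) ^ (1 - D) * windowSum (fun n => ‖α n‖ ^ 2) b n) := by
    intro b n
    rw [windowSum, windowSum, mul_sum, ENNReal.ofReal_sum_of_nonneg fun i _ => by positivity]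
  have hwindow : ∀ j ≤ d, ∀ b, ∫⁻ η, ENNReal.ofReal
        (‖windowSum (modulated α (Complex.exp (Complex.I * η))) b (2 ^ j)‖ ^ 2) ∂ν
      ≤ windowSum (fun n => ENNReal.ofReal (M * (2 ^ d) ^ (1 - D) * ‖α n‖ ^ 2)) b (2 ^ j) := by
    intro j hj b
    have hsum0 : 0 ≤ windowSum (fun n => ‖α n‖ ^ 2) b (2 ^ j) := sum_nonneg fun i _ => sq_nonneg _
    rw [hweight]
    refine (hM α b (2 ^ j)).trans (ENNReal.ofReal_le_ofReal ?_)
    push_cast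
    gcongr
    exact one_le_two
  refine (lintegral_dyadicEnergy_le (stronglyMeasurable_modulated_exp α) hwindow a).trans_eq ?_
  rw [hweight, ← Nat.cast_succ, ← ENNReal.ofReal_natCast, ← ENNReal.ofReal_mul (Nat.cast_nonneg _)]
  push_cast
  congr 1
  ring

theorem UniformlyHolder.ae_summable_sqrt_dyadicEnergy (hν : UniformlyHolder ν D) (hD0 : 0 ≤ D)
    (hD1 : D ≤ 1) (hsupp : ∀ᵐ x ∂ν, x ∈ Set.Ioo 0 (2 * π)) {α : ℕ → ℂ} {γ : ℝ} (hγ : 1 - D < γ)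
    (hdecay : Summable fun n : ℕ => (n : ℝ) ^ γ * ‖α n‖ ^ 2) :
    ∀ᵐ (η : ℝ) ∂ν, Summable fun k : ℕ =>
      (k + 1) * √(dyadicEnergy (modulated α (Complex.exp (Complex.I * η))) k (2 ^ k)) := by
  obtain ⟨M, hM0, hM⟩ := hν.exists_lintegral_dyadicEnergy_le hD0 hD1 hsupp
  set T : ℝ := ∑' n : ℕ, (n : ℝ) ^ γ * ‖α n‖ ^ 2
  have hblock : ∀ k : ℕ, (2 ^ k : ℝ) ^ (1 - D) * windowSum (fun n => ‖α n‖ ^ 2) (2 ^ k) (2 ^ k)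
      ≤ T * (2 ^ (1 - D - γ)) ^ k := by
    intro k
    calc (2 ^ k : ℝ) ^ (1 - D) * windowSum (fun n => ‖α n‖ ^ 2) (2 ^ k) (2 ^ k)
        ≤ (2 ^ k : ℝ) ^ (1 - D) * ((2 ^ k : ℝ) ^ (-γ) * T) := by
          gcongr
          exact_mod_cast windowSum_sq_norm_le_rpow_neg_mul_tsum (by linarith) hdecay
            (Nat.two_pow_pos k) (2 ^ k)
      _ = T * (2 ^ (1 - D - γ)) ^ k := by
          rw [Real.rpow_pow_comm two_pos.le, ← mul_assoc, ← Real.rpow_add (by positivity),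
            ← sub_eq_add_neg, mul_comm]
  refine ae_summable_mul_sqrt_of_lintegral_le_geometric (M := M * T) (r := 2 ^ (1 - D - γ))
    (fun k => measurable_dyadicEnergy (stronglyMeasurable_modulated_exp α) k (2 ^ k))
    (fun k η => dyadicEnergy_nonneg ..) (by positivity)
    (Real.rpow_lt_one_of_one_lt_of_neg one_lt_two (by linarith)) fun k => ?_
  refine (hM α k (2 ^ k)).trans (ENNReal.ofReal_le_ofReal ?_)
  calc _ ≤ M * ((k + 1) * (T * (2 ^ (1 - D - γ)) ^ k)) :=
        mul_le_mul_of_nonneg_left (mul_le_mul_of_nonneg_left (hblock k) (by positivity)) hM0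
    _ = M * T * ((k + 1) * (2 ^ (1 - D - γ)) ^ k) := by ring

end Holder

/-! ### The Szegő recurrence on the unit circle -/

/-- The real-linear map `w ↦ -conj (α n * z ^ (n + 1) * w)`, the increment of the Szegő recurrence
written for `z ^ (-n) * Φ_n(z)` at a point `z` of the unit circle. -/
noncomputable def szegoIncrement (α : ℕ → ℂ) (z : ℂ) (n : ℕ) : ℂ →L[ℝ] ℂ :=
  (-starRingEnd ℂ (modulated α z n * z)) • (Complex.conjCLE : ℂ →L[ℝ] ℂ)

theorem norm_windowSum_szegoIncrement (α : ℕ → ℂ) {z : ℂ} (hz : ‖z‖ = 1) (a n : ℕ) :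
    ‖windowSum (szegoIncrement α z) a n‖ = ‖windowSum (modulated α z) a n‖ := by
  have hsum : windowSum (szegoIncrement α z) a n
      = (-starRingEnd ℂ (windowSum (modulated α z) a n * z))
        • (Complex.conjCLE : ℂ →L[ℝ] ℂ) := by
    simp only [windowSum, szegoIncrement, ← sum_smul, sum_mul, map_sum, sum_neg_distrib]
  rw [hsum, norm_smul, Complex.conjCLE_norm, mul_one, norm_neg, RCLike.norm_conj, norm_mul, hz,
    mul_one]

theorem norm_windowSum_modulated_const_mul {c : ℂ} (hc : ‖c‖ = 1) (α : ℕ → ℂ) (z : ℂ)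
    (a n : ℕ) :
    ‖windowSum (modulated (fun k => c * α k) z) a n‖ = ‖windowSum (modulated α z) a n‖ := by
  simp only [windowSum, modulated, mul_assoc, ← mul_sum, norm_mul, hc, one_mul]

theorem eval_monicPoly_succ (α : ℕ → ℂ) {z : ℂ} (hz : ‖z‖ = 1) (n : ℕ) :
    (monicPoly α (n + 1)).eval z = z * (monicPoly α n).eval z
      - starRingEnd ℂ (α n) * (z ^ n * starRingEnd ℂ ((monicPoly α n).eval z)) := by
  have hz0 : z ≠ 0 := norm_ne_zero_iff.1 (hz ▸ one_ne_zero)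
  have hinv : 1 / starRingEnd ℂ z = z := by
    rw [one_div, ← map_inv₀, Complex.inv_eq_conj hz, Complex.conj_conj]
  rw [monicPoly, eval_sub, eval_mul, eval_mul, eval_X, eval_C,
    eval_szegoDual n _ (natDegree_monicPoly_le α n) z hz0, hinv]

theorem eval_monicPoly_eq_pow_mul_transfer (α : ℕ → ℂ) {z : ℂ} (hz : ‖z‖ = 1) (n : ℕ) :
    (monicPoly α n).eval z = z ^ n * transfer (szegoIncrement α z) 0 n 1 := by
  have hzz : z * starRingEnd ℂ z = 1 := by simp [Complex.mul_conj', hz]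
  induction n with
  | zero => simp [monicPoly, transfer]
  | succ n ih =>
    rw [eval_monicPoly_succ α hz, ih, transfer, zero_add]
    simp only [szegoIncrement, modulated, mul_apply_eq_comp, add_apply, one_apply_eq_self,
      smul_apply, ContinuousLinearEquiv.coe_coe, Complex.conjCLE_apply, map_mul, map_pow,
      smul_eq_mul]
    linear_combination (z ^ n * starRingEnd ℂ (α n) * starRingEnd ℂ z ^ n
      * starRingEnd ℂ (transfer (szegoIncrement α z) 0 n 1)) * hzz

theorem norm_eval_monicPoly_le (α : ℕ → ℂ) {z : ℂ} (hz : ‖z‖ = 1) (n : ℕ) :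
    ‖(monicPoly α n).eval z‖ ≤ ‖transfer (szegoIncrement α z) 0 n‖ := by
  rw [eval_monicPoly_eq_pow_mul_transfer α hz, norm_mul, norm_pow, hz, one_pow, one_mul]
  simpa using (transfer (szegoIncrement α z) 0 n).le_opNorm 1

theorem exists_forall_pruferRadius_le {α : ℕ → ℂ} {η : ℝ} (hsum : Summable fun k : ℕ =>
      (k + 1) * √(dyadicEnergy (modulated α (Complex.exp (Complex.I * η))) k (2 ^ k))) :
    ∃ C : ℝ, ∀ (β : ℝ) (n : ℕ), pruferRadius α n η β ≤ C := by
  obtain ⟨C, hC⟩ := exists_forall_norm_transfer_le (ℂ →L[ℝ] ℂ) hsum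
  refine ⟨C, fun β n => (norm_eval_monicPoly_le _ (Complex.norm_exp_I_mul_ofReal η) n).trans
    (hC _ (fun a m => ?_) n)⟩
  rw [norm_windowSum_szegoIncrement _ (Complex.norm_exp_I_mul_ofReal η),
    norm_windowSum_modulated_const_mul (Complex.norm_exp_I_mul_ofReal β)]

end OPUC

theorem theorem4p1_general (α : ℕ → ℂ) (γ : ℝ)
    (hdecay : Summable fun n : ℕ => (n : ℝ) ^ γ * ‖α n‖ ^ 2)
    (ν : MeasureTheory.Measure ℝ) (hsupp : ∀ᵐ η ∂ν, η ∈ Set.Ioo 0 (2 * Real.pi))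
    (D : ℝ) (hD0 : 0 ≤ D) (hD1 : D ≤ 1) (hγ : 1 - D < γ) (hHolder : OPUC.UniformlyHolder ν D) :
    ∀ᵐ η ∂ν, ∃ C : ℝ, ∀ (β : ℝ) (n : ℕ), OPUC.pruferRadius α n η β ≤ C :=
  (hHolder.ae_summable_sqrt_dyadicEnergy hD0 hD1 hsupp hγ hdecay).mono
    fun _ hη => OPUC.exists_forall_pruferRadius_le hη

theorem theorem4p1 (α : ℕ → ℂ) (hα : ∀ n, ‖α n‖ < 1)
    (γ : ℝ) (hγ0 : 0 < γ) (hγ1 : γ < 1)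
    (hdecay : Summable fun n : ℕ => (n : ℝ) ^ γ * ‖α n‖ ^ 2)
    (ν : MeasureTheory.Measure ℝ) [MeasureTheory.IsFiniteMeasure ν]
    (δ : ℝ) (hδ : 0 < δ) (hsupp : ν (Set.Ioo δ (2 * Real.pi - δ))ᶜ = 0)
    (D : ℝ) (hD0 : 1 - γ < D) (hD1 : D < 1) (hHolder : OPUC.UniformlyHolder ν D) :
    ∀ᵐ η ∂ν, BddAbove
      {r : ℝ | ∃ β ∈ Set.Ico 0 (2 * Real.pi), ∃ n : ℕ, r = OPUC.pruferRadius α n η β} := by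
  have hsupp' : ∀ᵐ η ∂ν, η ∈ Set.Ioo 0 (2 * Real.pi) := by
    filter_upwards [MeasureTheory.mem_ae_iff.2 hsupp] with η hη
    exact ⟨hδ.trans hη.1, hη.2.trans (sub_lt_self _ hδ)⟩
  filter_upwards [theorem4p1_general α γ hdecay ν hsupp' D (by linarith) hD1.le (by linarith)
    hHolder] with η ⟨C, hC⟩
  refine ⟨C, ?_⟩
  rintro _ ⟨β, -, n, rfl⟩
  exact hC β n
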